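/- Let $k$ be a field of characteristic zero. A \emph{nonunital operad} is a sequence $S=\{S(n)\}_{n\ge 1}$ of $\mathbb Z$-graded $k$-vector spaces with linear degree zero left actions of the symmetric groups $\Sigma_n$ and degree zero linear maps $\circ_i\colon S(m)\otimes S(n)\to S(m+n-1)$, $1\le i\le n$ ($f\circ_i g$ is $f$ inserted into the $i$-th input of $g$), which are equivariant in the usual sense and satisfy, for homogeneous $f\in S(a)$, $g\in S(b)$, $h\in S(c)$, $$f\circ_i(g\circ_j h)=\begin{cases}(-1)^{|f||g|}\,g\circ_{j+a-1}(f\circ_i h), & 1\le i\le j-1,\\ (f\circ_{i-j+1}g)\circ_j h, & j\le i\le b+j-1,\\ (-1)^{|f||g|}\,g\circ_j(f\circ_{i-b+1}h), & i\ge j+b.\end{cases}$$ A \emph{collection} is a sequence $E=\{E(n)\}_{n\ge2}$ of $\mathbb Z$-graded $k$-vector spaces with linear degree zero left $\Sigma_n$-actions; its maps are the equivariant linear maps of degree zero. Let $\mathcal F(E)$ be the free nonunital operad on a collection $E$, and let $\mathcal F^l(E)\subset\mathcal F(E)$ be the span of the composites of exactly $l$ generators, $\mathcal F^{\ge2}(E)=\sum_{l\ge2}\mathcal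 F^l(E)$. For a nonunital operad $S$, let the decomposables $D(S)(n)\subset S(n)$ be the span of all elements $\sigma(f\circ_i g)$ with $f\in S(a)$, $g\in S(b)$, $a,b\ge1$, $a+b-1=n$, $1\le i\le b$, $\sigma\in\Sigma_n$, and let $Q(S)=S/D(S)$ be the indecomposables. Let $S$ be a nonunital operad with $S(1)=0$, and $Q=Q(S)$, $\pi\colon S\to Q$ the projection. Then $\pi$ has an equivariant section (a map of collections $s\colon Q\to S$ with $\pi s=\mathrm{id}$), and for every such $s$ the homomorphism of operads $\alpha\colon\mathcal F(Q)\to S$ with $\alpha|_Q=s$ has the following properties. (i) $\alpha$ is an epimorphism, i.e. each $\alpha(n)$ is surjective. (ii) $\operatorname{Ker}(\alpha)\subset\mathcal F^{\ge2}(Q)=D(\mathcal F(Q))$. (iii) For any collection $Q'$ and any epimorphism of operads $\alpha'\colon\mathcal F(Q')\to S$ (each $\alpha'(n)$ surjective) there is a monomorphism of operads $\beta\colon\mathcal F(Q)\to\mathcal F(Q')$ (each $\beta(n)$ injective) with $\alpha'\circ\beta=\alpha$. -/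

import Mathlib

universe u v w

/-! ### Graded collections -/

/-- A sequence `{E(n) ; n ≥ 1}` of `ℤ`-graded `k`-vector spaces `E(n) = ⨁ₚ E(n)ₚ`, each with a
degree zero `k`-linear left action of the symmetric group `Σₙ`. The homogeneous component
`E(n)ₚ` is `E.obj n p`. -/
structure GrCollection (k : Type u) [Field k] where
  obj : ℕ+ → ℤ → Type v
  [addCommGroup : ∀ n p, AddCommGroup (obj n p)]
  [module : ∀ n p, Module k (obj n p)]
  action : ∀ (n : ℕ+) (p : ℤ), Representation k (Equiv.Perm (Fin n)) (obj n p)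

attribute [instance] GrCollection.addCommGroup GrCollection.module

/-- `E(1) = 0`, i.e. `E` is a sequence indexed by the arities `n ≥ 2`. -/
def GrCollection.IsReduced {k : Type u} [Field k] (E : GrCollection.{u, v} k) : Prop :=
  ∀ (p : ℤ) (x : E.obj 1 p), x = 0

/-- Equivariant maps of collections (linear, of degree zero). -/
structure GrCollection.Hom {k : Type u} [Field k]
    (E : GrCollection.{u, v} k) (F : GrCollection.{u, w} k) where
  toLin : ∀ n p, E.obj n p →ₗ[k] F.obj n p
  map_action : ∀ (n : ℕ+) (p : ℤ) (σ : Equiv.Perm (Fin n)) (x : E.obj n p),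
    toLin n p (E.action n p σ x) = F.action n p σ (toLin n p x)

/-! ### Insertion of permutations -/

/-- The inputs of `f ∘ⱼ g` (`f` of arity `m` plugged into the input `j` of `g`, which has arity
`n`; all inputs are numbered from `0`): the inputs of `g` other than `j`, together with those
of `f`. The inputs of `f` occupy the places `j, …, j + m - 1`. -/
def slotEquiv {m n l : ℕ+} (h : (m : ℕ) + n = l + 1) (j : Fin n) :
    {t : Fin n // t ≠ j} ⊕ Fin m ≃ Fin l where
  toFun
    | Sum.inl t => ⟨if t.1.1 < j.1 then t.1.1 else t.1.1 + m - 1, by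
        have h1 := t.1.2; have h2 := m.pos; have h3 := j.2
        have h4 : t.1.1 ≠ j.1 := fun e => t.2 (Fin.ext e)
        split_ifs <;> omega⟩
    | Sum.inr y => ⟨j.1 + y.1, by have h1 := y.2; have h3 := j.2; omega⟩
  invFun z :=
    if h1 : z.1 < j.1 then Sum.inl ⟨⟨z.1, by have := j.2; omega⟩, by
      intro e; rw [← e] at h1; exact lt_irrefl _ h1⟩
    else if h2 : z.1 < j.1 + m then Sum.inr ⟨z.1 - j.1, by omega⟩
    else Sum.inl ⟨⟨z.1 + 1 - m, by have := z.2; omega⟩, by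
      intro e; have := congrArg Fin.val e; simp only at this; omega⟩
  left_inv s := by
    have h2 := m.pos
    rcases s with ⟨t, ht⟩ | y
    · have h4 : t.1 ≠ j.1 := fun e => ht (Fin.ext e)
      by_cases h1 : t.1 < j.1
      · simp [h1]
      · have h5 : ¬ (t.1 + m - 1 < j.1) := by omega
        have h6 : ¬ (t.1 + m - 1 < j.1 + m) := by omega
        simp only [h1, if_false, h5, h6, dif_neg, not_false_eq_true]
        congr 2
        apply Fin.ext
        simp only
        omega
    · have h5 : ¬ (j.1 + y.1 < j.1) := by omega
      have h6 : j.1 + y.1 < j.1 + m := by have := y.2; omega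
      simp
  right_inv z := by
    have h2 := m.pos
    by_cases h1 : z.1 < j.1
    · simp [h1]
    · by_cases h3 : z.1 < j.1 + m
      · simp only [h1, h3, dif_neg, dif_pos, not_false_eq_true]
        apply Fin.ext
        simp only
        omega
      · have h5 : ¬ (z.1 + 1 - m < j.1) := by omega
        simp only [h1, h3, dif_neg, not_false_eq_true, h5, if_false]
        apply Fin.ext
        simp only
        omega

/-- The permutation of the inputs of `f ∘ⱼ g` obtained by inserting `σ` into `τ`: an input `t` of
`g` is moved to the input `τ t`, and an input `y` of `f` to the input `σ y` of the block which
is now at the place `τ j`. -/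
def insertPerm {m n l : ℕ+} (h : (m : ℕ) + n = l + 1)
    (σ : Equiv.Perm (Fin m)) (τ : Equiv.Perm (Fin n)) (j : Fin n) : Equiv.Perm (Fin l) :=
  ((slotEquiv h j).symm.trans
    (Equiv.sumCongr (τ.subtypeEquiv (fun _ => (τ.injective.ne_iff (y := j)).symm)) σ)).trans
      (slotEquiv h (τ j))

/-! ### Nonunital operads -/

/-- A nonunital (symmetric) operad in graded vector spaces over `k`, in terms of partial
compositions. The element `f ∘ᵢ g`, for `f ∈ S(m)`, `g ∈ S(n)` and an input `i` of `g`, is the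
result of plugging `f` into the input `i` of `g`. It lies in `S(l)`, where `l = m + n - 1`, and is
denoted by `comp h hd i f g`; here `h` and `hd` record the arities and the degrees. Inputs are
numbered from `0`. -/
structure NonunitalOperad (k : Type u) [Field k] extends GrCollection.{u, v} k where
  comp : ∀ {m n l : ℕ+} {p q r : ℤ}, (m : ℕ) + n = l + 1 → p + q = r → Fin n →
    (obj m p →ₗ[k] obj n q →ₗ[k] obj l r)
  /-- `f` is plugged into an input of `h` on the left of `g`. -/
  assoc_left : ∀ {a b c bc ac l : ℕ+} {p q r qr pr t : ℤ}
    (h₁ : (b : ℕ) + c = bc + 1) (h₂ : (a : ℕ) + bc = l + 1)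
    (h₃ : (a : ℕ) + c = ac + 1) (h₄ : (b : ℕ) + ac = l + 1)
    (d₁ : q + r = qr) (d₂ : p + qr = t) (d₃ : p + r = pr) (d₄ : q + pr = t)
    (i j : Fin c) (i' : Fin bc) (j' : Fin ac),
    (i : ℕ) < j → (i' : ℕ) = i → (j' : ℕ) + 1 = j + a →
    ∀ (f : obj a p) (g : obj b q) (h : obj c r),
      comp h₂ d₂ i' f (comp h₁ d₁ j g h) =
        ((-1 : k) ^ (p * q)) • comp h₄ d₄ j' g (comp h₃ d₃ i f h)
  /-- `f` is plugged into an input of `g`. -/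
  assoc_mid : ∀ {a b c bc ab l : ℕ+} {p q r qr pq t : ℤ}
    (h₁ : (b : ℕ) + c = bc + 1) (h₂ : (a : ℕ) + bc = l + 1)
    (h₃ : (a : ℕ) + b = ab + 1) (h₄ : (ab : ℕ) + c = l + 1)
    (d₁ : q + r = qr) (d₂ : p + qr = t) (d₃ : p + q = pq) (d₄ : pq + r = t)
    (i : Fin b) (j : Fin c) (i' : Fin bc), (i' : ℕ) = j + i →
    ∀ (f : obj a p) (g : obj b q) (h : obj c r),
      comp h₂ d₂ i' f (comp h₁ d₁ j g h) = comp h₄ d₄ j (comp h₃ d₃ i f g) h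
  /-- `f` is plugged into an input of `h` on the right of `g`. -/
  assoc_right : ∀ {a b c bc ac l : ℕ+} {p q r qr pr t : ℤ}
    (h₁ : (b : ℕ) + c = bc + 1) (h₂ : (a : ℕ) + bc = l + 1)
    (h₃ : (a : ℕ) + c = ac + 1) (h₄ : (b : ℕ) + ac = l + 1)
    (d₁ : q + r = qr) (d₂ : p + qr = t) (d₃ : p + r = pr) (d₄ : q + pr = t)
    (i j : Fin c) (i' : Fin bc) (j' : Fin ac),
    (j : ℕ) < i → (i' : ℕ) + 1 = i + b → (j' : ℕ) = j →
    ∀ (f : obj a p) (g : obj b q) (h : obj c r),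
      comp h₂ d₂ i' f (comp h₁ d₁ j g h) =
        ((-1 : k) ^ (p * q)) • comp h₄ d₄ j' g (comp h₃ d₃ i f h)
  equivariant : ∀ {m n l : ℕ+} {p q r : ℤ} (h : (m : ℕ) + n = l + 1) (hd : p + q = r)
    (j : Fin n) (σ : Equiv.Perm (Fin m)) (τ : Equiv.Perm (Fin n)) (f : obj m p) (g : obj n q),
      comp h hd (τ j) (action m p σ f) (action n q τ g) =
        action l r (insertPerm h σ τ j) (comp h hd j f g)

/-- Homomorphisms of nonunital operads. -/
structure NonunitalOperad.Hom {k : Type u} [Field k]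
    (S : NonunitalOperad.{u, v} k) (T : NonunitalOperad.{u, w} k)
    extends GrCollection.Hom S.toGrCollection T.toGrCollection where
  map_comp : ∀ {m n l : ℕ+} {p q r : ℤ} (h : (m : ℕ) + n = l + 1) (hd : p + q = r)
    (i : Fin n) (f : S.obj m p) (g : S.obj n q),
      toLin l r (S.comp h hd i f g) = T.comp h hd i (toLin m p f) (toLin n q g)

/-- All components are surjective. -/
def NonunitalOperad.Hom.IsEpi {k : Type u} [Field k]
    {S : NonunitalOperad.{u, v} k} {T : NonunitalOperad.{u, w} k} (φ : S.Hom T) : Prop :=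
  ∀ n p, Function.Surjective (φ.toLin n p)

/-- All components are injective. -/
def NonunitalOperad.Hom.IsMono {k : Type u} [Field k]
    {S : NonunitalOperad.{u, v} k} {T : NonunitalOperad.{u, w} k} (φ : S.Hom T) : Prop :=
  ∀ n p, Function.Injective (φ.toLin n p)

/-! ### Decomposables and indecomposables -/

namespace NonunitalOperad

variable {k : Type u} [Field k] (S : NonunitalOperad.{u, v} k)

/-- The decomposables `D(S)(n)` (in degree `p`): the span of the elements `σ (f ∘ᵢ g)`. -/
def decomposables (n : ℕ+) (p : ℤ) : Submodule k (S.obj n p) :=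
  Submodule.span k {y | ∃ (a b : ℕ+) (d e : ℤ) (h : (a : ℕ) + b = n + 1) (hd : d + e = p)
    (i : Fin b) (f : S.obj a d) (g : S.obj b e) (σ : Equiv.Perm (Fin n)),
      y = S.action n p σ (S.comp h hd i f g)}

theorem decomposables_le_comap (n : ℕ+) (p : ℤ) (σ : Equiv.Perm (Fin n)) :
    S.decomposables n p ≤ (S.decomposables n p).comap (S.action n p σ) := by
  refine Submodule.span_le.2 ?_
  rintro y ⟨a, b, d, e, h, hd, i, f, g, τ, rfl⟩
  refine Submodule.subset_span ⟨a, b, d, e, h, hd, i, f, g, σ * τ, ?_⟩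
  rw [map_mul]
  rfl

/-- The collection `Q(S) = S / D(S)` of indecomposables. -/
def indecomposables : GrCollection.{u, v} k where
  obj n p := S.obj n p ⧸ S.decomposables n p
  action n p :=
    { toFun := fun σ => (S.decomposables n p).mapQ (S.decomposables n p) (S.action n p σ)
        (S.decomposables_le_comap n p σ)
      map_one' := by
        ext y
        simp
      map_mul' := fun σ τ => by
        ext y
        simp }

/-- The natural projection `π : S → Q(S)`. -/
def projection : S.toGrCollection.Hom S.indecomposables where
  toLin n p := (S.decomposables n p).mkQ
  map_action _ _ _ _ := rfl

/-- `s` is an equivariant section of the projection `π : S → Q(S)`. -/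
def IsSection (s : S.indecomposables.Hom S.toGrCollection) : Prop :=
  ∀ n p (y : S.indecomposables.obj n p), S.projection.toLin n p (s.toLin n p y) = y

end NonunitalOperad

/-! ### The free operad -/

namespace FreeOperad

variable {k : Type u} [Field k]

/-- Formal expressions in the elements of a collection `E` and the operations of an operad. -/
inductive Term (E : GrCollection.{u, v} k) : ℕ+ → ℤ → Type (max u v)
  | of {n : ℕ+} {p : ℤ} (y : E.obj n p) : Term E n p
  | zero {n : ℕ+} {p : ℤ} : Term E n p
  | add {n : ℕ+} {p : ℤ} (y z : Term E n p) : Term E n p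
  | smul {n : ℕ+} {p : ℤ} (c : k) (y : Term E n p) : Term E n p
  | act {n : ℕ+} {p : ℤ} (σ : Equiv.Perm (Fin n)) (y : Term E n p) : Term E n p
  | comp {m n l : ℕ+} {p q r : ℤ} (h : (m : ℕ) + n = l + 1) (hd : p + q = r) (i : Fin n)
      (f : Term E m p) (g : Term E n q) : Term E l r

open Term in
/-- The smallest congruence on formal expressions for which the quotient is a nonunital operad and
the inclusion of `E` is a map of collections. -/
inductive Rel (E : GrCollection.{u, v} k) :
    ∀ {n : ℕ+} {p : ℤ}, Term E n p → Term E n p → Prop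
  | refl {n : ℕ+} {p : ℤ} (y : Term E n p) : Rel E y y
  | symm {n : ℕ+} {p : ℤ} {y z : Term E n p} : Rel E y z → Rel E z y
  | trans {n : ℕ+} {p : ℤ} {y z t : Term E n p} : Rel E y z → Rel E z t → Rel E y t
  | add_congr {n : ℕ+} {p : ℤ} {y y' z z' : Term E n p} :
      Rel E y y' → Rel E z z' → Rel E (add y z) (add y' z')
  | smul_congr {n : ℕ+} {p : ℤ} (c : k) {y y' : Term E n p} :
      Rel E y y' → Rel E (smul c y) (smul c y')
  | act_congr {n : ℕ+} {p : ℤ} (σ : Equiv.Perm (Fin n)) {y y' : Term E n p} :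
      Rel E y y' → Rel E (act σ y) (act σ y')
  | comp_congr {m n l : ℕ+} {p q r : ℤ} (h : (m : ℕ) + n = l + 1) (hd : p + q = r) (i : Fin n)
      {f f' : Term E m p} {g g' : Term E n q} :
      Rel E f f' → Rel E g g' → Rel E (comp h hd i f g) (comp h hd i f' g')
  -- each component is a vector space
  | add_assoc {n : ℕ+} {p : ℤ} (y z t : Term E n p) : Rel E (add (add y z) t) (add y (add z t))
  | add_comm {n : ℕ+} {p : ℤ} (y z : Term E n p) : Rel E (add y z) (add z y)
  | zero_add {n : ℕ+} {p : ℤ} (y : Term E n p) : Rel E (add zero y) y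
  | neg_add {n : ℕ+} {p : ℤ} (y : Term E n p) : Rel E (add (smul (-1) y) y) zero
  | smul_add {n : ℕ+} {p : ℤ} (c : k) (y z : Term E n p) :
      Rel E (smul c (add y z)) (add (smul c y) (smul c z))
  | add_smul {n : ℕ+} {p : ℤ} (c d : k) (y : Term E n p) :
      Rel E (smul (c + d) y) (add (smul c y) (smul d y))
  | mul_smul {n : ℕ+} {p : ℤ} (c d : k) (y : Term E n p) :
      Rel E (smul (c * d) y) (smul c (smul d y))
  | one_smul {n : ℕ+} {p : ℤ} (y : Term E n p) : Rel E (smul 1 y) y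
  -- the symmetric groups act linearly
  | act_add {n : ℕ+} {p : ℤ} (σ : Equiv.Perm (Fin n)) (y z : Term E n p) :
      Rel E (act σ (add y z)) (add (act σ y) (act σ z))
  | act_smul {n : ℕ+} {p : ℤ} (σ : Equiv.Perm (Fin n)) (c : k) (y : Term E n p) :
      Rel E (act σ (smul c y)) (smul c (act σ y))
  | act_one {n : ℕ+} {p : ℤ} (y : Term E n p) : Rel E (act 1 y) y
  | act_mul {n : ℕ+} {p : ℤ} (σ τ : Equiv.Perm (Fin n)) (y : Term E n p) :
      Rel E (act (σ * τ) y) (act σ (act τ y))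
  -- the compositions are bilinear
  | comp_add_left {m n l : ℕ+} {p q r : ℤ} (h : (m : ℕ) + n = l + 1) (hd : p + q = r) (i : Fin n)
      (f f' : Term E m p) (g : Term E n q) :
      Rel E (comp h hd i (add f f') g) (add (comp h hd i f g) (comp h hd i f' g))
  | comp_smul_left {m n l : ℕ+} {p q r : ℤ} (h : (m : ℕ) + n = l + 1) (hd : p + q = r) (i : Fin n)
      (c : k) (f : Term E m p) (g : Term E n q) :
      Rel E (comp h hd i (smul c f) g) (smul c (comp h hd i f g))
  | comp_add_right {m n l : ℕ+} {p q r : ℤ} (h : (m : ℕ) + n = l + 1) (hd : p + q = r) (i : Fin n)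
      (f : Term E m p) (g g' : Term E n q) :
      Rel E (comp h hd i f (add g g')) (add (comp h hd i f g) (comp h hd i f g'))
  | comp_smul_right {m n l : ℕ+} {p q r : ℤ} (h : (m : ℕ) + n = l + 1) (hd : p + q = r) (i : Fin n)
      (c : k) (f : Term E m p) (g : Term E n q) :
      Rel E (comp h hd i f (smul c g)) (smul c (comp h hd i f g))
  -- the axioms of a nonunital operad
  | assoc_left {a b c bc ac l : ℕ+} {p q r qr pr t : ℤ}
      (h₁ : (b : ℕ) + c = bc + 1) (h₂ : (a : ℕ) + bc = l + 1)
      (h₃ : (a : ℕ) + c = ac + 1) (h₄ : (b : ℕ) + ac = l + 1)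
      (d₁ : q + r = qr) (d₂ : p + qr = t) (d₃ : p + r = pr) (d₄ : q + pr = t)
      (i j : Fin c) (i' : Fin bc) (j' : Fin ac)
      (hij : (i : ℕ) < j) (hi : (i' : ℕ) = i) (hj : (j' : ℕ) + 1 = j + a)
      (f : Term E a p) (g : Term E b q) (h : Term E c r) :
      Rel E (comp h₂ d₂ i' f (comp h₁ d₁ j g h))
        (smul ((-1 : k) ^ (p * q)) (comp h₄ d₄ j' g (comp h₃ d₃ i f h)))
  | assoc_mid {a b c bc ab l : ℕ+} {p q r qr pq t : ℤ}
      (h₁ : (b : ℕ) + c = bc + 1) (h₂ : (a : ℕ) + bc = l + 1)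
      (h₃ : (a : ℕ) + b = ab + 1) (h₄ : (ab : ℕ) + c = l + 1)
      (d₁ : q + r = qr) (d₂ : p + qr = t) (d₃ : p + q = pq) (d₄ : pq + r = t)
      (i : Fin b) (j : Fin c) (i' : Fin bc) (hi : (i' : ℕ) = j + i)
      (f : Term E a p) (g : Term E b q) (h : Term E c r) :
      Rel E (comp h₂ d₂ i' f (comp h₁ d₁ j g h)) (comp h₄ d₄ j (comp h₃ d₃ i f g) h)
  | assoc_right {a b c bc ac l : ℕ+} {p q r qr pr t : ℤ}
      (h₁ : (b : ℕ) + c = bc + 1) (h₂ : (a : ℕ) + bc = l + 1)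
      (h₃ : (a : ℕ) + c = ac + 1) (h₄ : (b : ℕ) + ac = l + 1)
      (d₁ : q + r = qr) (d₂ : p + qr = t) (d₃ : p + r = pr) (d₄ : q + pr = t)
      (i j : Fin c) (i' : Fin bc) (j' : Fin ac)
      (hij : (j : ℕ) < i) (hi : (i' : ℕ) + 1 = i + b) (hj : (j' : ℕ) = j)
      (f : Term E a p) (g : Term E b q) (h : Term E c r) :
      Rel E (comp h₂ d₂ i' f (comp h₁ d₁ j g h))
        (smul ((-1 : k) ^ (p * q)) (comp h₄ d₄ j' g (comp h₃ d₃ i f h)))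
  | equivariant {m n l : ℕ+} {p q r : ℤ} (h : (m : ℕ) + n = l + 1) (hd : p + q = r)
      (j : Fin n) (σ : Equiv.Perm (Fin m)) (τ : Equiv.Perm (Fin n))
      (f : Term E m p) (g : Term E n q) :
      Rel E (comp h hd (τ j) (act σ f) (act τ g)) (act (insertPerm h σ τ j) (comp h hd j f g))
  -- the inclusion of `E` is a map of collections
  | of_add {n : ℕ+} {p : ℤ} (y z : E.obj n p) : Rel E (of (y + z)) (add (of y) (of z))
  | of_smul {n : ℕ+} {p : ℤ} (c : k) (y : E.obj n p) : Rel E (of (c • y)) (smul c (of y))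
  | of_act {n : ℕ+} {p : ℤ} (σ : Equiv.Perm (Fin n)) (y : E.obj n p) :
      Rel E (of (E.action n p σ y)) (act σ (of y))

variable (E : GrCollection.{u, v} k)

instance setoid (n : ℕ+) (p : ℤ) : Setoid (Term E n p) :=
  ⟨Rel E, Rel.refl, Rel.symm, Rel.trans⟩

/-- The component of arity `n` and degree `p` of the free operad on `E`. -/
def Carrier (n : ℕ+) (p : ℤ) : Type (max u v) := Quotient (setoid E n p)

variable {n : ℕ+} {p : ℤ}

instance : Zero (Carrier E n p) := ⟨Quotient.mk _ Term.zero⟩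
instance : Add (Carrier E n p) :=
  ⟨Quotient.map₂ Term.add fun _ _ h₁ _ _ h₂ => Rel.add_congr h₁ h₂⟩
instance : SMul k (Carrier E n p) :=
  ⟨fun c => Quotient.map (Term.smul c) fun _ _ h => Rel.smul_congr c h⟩
instance : Neg (Carrier E n p) := ⟨fun y => (-1 : k) • y⟩

instance : AddCommGroup (Carrier E n p) where
  add_assoc := by
    rintro ⟨a⟩ ⟨b⟩ ⟨c⟩
    exact Quotient.sound (Rel.add_assoc a b c)
  zero_add := by
    rintro ⟨a⟩
    exact Quotient.sound (Rel.zero_add a)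
  add_zero := by
    rintro ⟨a⟩
    exact Quotient.sound (Rel.trans (Rel.add_comm _ _) (Rel.zero_add a))
  nsmul := nsmulRec
  zsmul := zsmulRec
  neg_add_cancel := by
    rintro ⟨a⟩
    exact Quotient.sound (Rel.neg_add a)
  add_comm := by
    rintro ⟨a⟩ ⟨b⟩
    exact Quotient.sound (Rel.add_comm a b)

instance : Module k (Carrier E n p) :=
  Module.ofMinimalAxioms
    (by rintro c ⟨y⟩ ⟨z⟩; exact Quotient.sound (Rel.smul_add c y z))
    (by rintro c d ⟨y⟩; exact Quotient.sound (Rel.add_smul c d y))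
    (by rintro c d ⟨y⟩; exact Quotient.sound (Rel.mul_smul c d y))
    (by rintro ⟨y⟩; exact Quotient.sound (Rel.one_smul y))

/-- The action of the symmetric groups on the free operad. -/
def action (n : ℕ+) (p : ℤ) : Representation k (Equiv.Perm (Fin n)) (Carrier E n p) where
  toFun σ :=
    { toFun := Quotient.map (Term.act σ) fun _ _ h => Rel.act_congr σ h
      map_add' := by
        rintro ⟨y⟩ ⟨z⟩
        exact Quotient.sound (Rel.act_add σ y z)
      map_smul' := by
        rintro c ⟨y⟩
        exact Quotient.sound (Rel.act_smul σ c y) }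
  map_one' := by
    ext ⟨y⟩
    exact Quotient.sound (Rel.act_one y)
  map_mul' σ τ := by
    ext ⟨y⟩
    exact Quotient.sound (Rel.act_mul σ τ y)

/-- The compositions of the free operad. -/
def comp {m n l : ℕ+} {p q r : ℤ} (h : (m : ℕ) + n = l + 1) (hd : p + q = r) (i : Fin n) :
    Carrier E m p →ₗ[k] Carrier E n q →ₗ[k] Carrier E l r :=
  LinearMap.mk₂ k
    (Quotient.map₂ (Term.comp h hd i) fun _ _ h₁ _ _ h₂ => Rel.comp_congr h hd i h₁ h₂)
    (by rintro ⟨f⟩ ⟨f'⟩ ⟨g⟩; exact Quotient.sound (Rel.comp_add_left h hd i f f' g))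
    (by rintro c ⟨f⟩ ⟨g⟩; exact Quotient.sound (Rel.comp_smul_left h hd i c f g))
    (by rintro ⟨f⟩ ⟨g⟩ ⟨g'⟩; exact Quotient.sound (Rel.comp_add_right h hd i f g g'))
    (by rintro c ⟨f⟩ ⟨g⟩; exact Quotient.sound (Rel.comp_smul_right h hd i c f g))

end FreeOperad

open FreeOperad in
/-- The free nonunital operad `F(E)` on the collection `E`. -/
def FreeOperad {k : Type u} [Field k] (E : GrCollection.{u, v} k) :
    NonunitalOperad.{u, max u v} k where
  obj := Carrier E
  action := action E
  comp := comp E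
  assoc_left := by
    rintro a b c bc ac l p q r qr pr t h₁ h₂ h₃ h₄ d₁ d₂ d₃ d₄ i j i' j' hij hi hj ⟨f⟩ ⟨g⟩ ⟨h⟩
    exact Quotient.sound (Rel.assoc_left h₁ h₂ h₃ h₄ d₁ d₂ d₃ d₄ i j i' j' hij hi hj f g h)
  assoc_mid := by
    rintro a b c bc ab l p q r qr pq t h₁ h₂ h₃ h₄ d₁ d₂ d₃ d₄ i j i' hi ⟨f⟩ ⟨g⟩ ⟨h⟩
    exact Quotient.sound (Rel.assoc_mid h₁ h₂ h₃ h₄ d₁ d₂ d₃ d₄ i j i' hi f g h)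
  assoc_right := by
    rintro a b c bc ac l p q r qr pr t h₁ h₂ h₃ h₄ d₁ d₂ d₃ d₄ i j i' j' hij hi hj ⟨f⟩ ⟨g⟩ ⟨h⟩
    exact Quotient.sound (Rel.assoc_right h₁ h₂ h₃ h₄ d₁ d₂ d₃ d₄ i j i' j' hij hi hj f g h)
  equivariant := by
    rintro m n l p q r h hd j σ τ ⟨f⟩ ⟨g⟩
    exact Quotient.sound (Rel.equivariant h hd j σ τ f g)

namespace FreeOperad

variable {k : Type u} [Field k]

/-- The inclusion of generators `E → F(E)`. -/
def of (E : GrCollection.{u, v} k) : E.Hom (FreeOperad E).toGrCollection where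
  toLin n p :=
    { toFun := fun y => (Quotient.mk _ (Term.of y) : Carrier E n p)
      map_add' := fun y z => Quotient.sound (Rel.of_add y z)
      map_smul' := fun c y => Quotient.sound (Rel.of_smul c y) }
  map_action _ _ σ y := Quotient.sound (Rel.of_act σ y)

variable {E : GrCollection.{u, v} k} {T : NonunitalOperad.{u, w} k}

/-- The value of a formal expression in an operad `T`, given the values of the generators. -/
def Term.eval (s : E.Hom T.toGrCollection) : ∀ {n : ℕ+} {p : ℤ}, Term E n p → T.obj n p
  | _, _, .of y => s.toLin _ _ y
  | _, _, .zero => 0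
  | _, _, .add y z => y.eval s + z.eval s
  | _, _, .smul c y => c • y.eval s
  | _, _, .act σ y => T.action _ _ σ (y.eval s)
  | _, _, .comp h hd i f g => T.comp h hd i (f.eval s) (g.eval s)

theorem Rel.eval_eq (s : E.Hom T.toGrCollection) {n : ℕ+} {p : ℤ} {y z : Term E n p}
    (h : Rel E y z) : y.eval s = z.eval s := by
  induction h with
  | refl => rfl
  | symm _ ih => exact ih.symm
  | trans _ _ ih₁ ih₂ => exact ih₁.trans ih₂
  | add_congr _ _ ih₁ ih₂ => simp only [Term.eval, ih₁, ih₂]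
  | smul_congr _ _ ih => simp only [Term.eval, ih]
  | act_congr _ _ ih => simp only [Term.eval, ih]
  | comp_congr _ _ _ _ _ ih₁ ih₂ => simp only [Term.eval, ih₁, ih₂]
  | add_assoc => exact _root_.add_assoc _ _ _
  | add_comm => exact _root_.add_comm _ _
  | zero_add => exact _root_.zero_add _
  | neg_add => simp [Term.eval]
  | smul_add => exact _root_.smul_add _ _ _
  | add_smul => exact _root_.add_smul _ _ _
  | mul_smul => exact SemigroupAction.mul_smul _ _ _
  | one_smul => exact _root_.one_smul _ _
  | act_add => simp [Term.eval]
  | act_smul => simp [Term.eval]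
  | act_one => simp [Term.eval]
  | act_mul => simp [Term.eval]
  | comp_add_left => simp [Term.eval]
  | comp_smul_left => simp [Term.eval]
  | comp_add_right => simp [Term.eval]
  | comp_smul_right => simp [Term.eval]
  | assoc_left h₁ h₂ h₃ h₄ d₁ d₂ d₃ d₄ i j i' j' hij hi hj f g h =>
    exact T.assoc_left h₁ h₂ h₃ h₄ d₁ d₂ d₃ d₄ i j i' j' hij hi hj _ _ _
  | assoc_mid h₁ h₂ h₃ h₄ d₁ d₂ d₃ d₄ i j i' hi f g h =>
    exact T.assoc_mid h₁ h₂ h₃ h₄ d₁ d₂ d₃ d₄ i j i' hi _ _ _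
  | assoc_right h₁ h₂ h₃ h₄ d₁ d₂ d₃ d₄ i j i' j' hij hi hj f g h =>
    exact T.assoc_right h₁ h₂ h₃ h₄ d₁ d₂ d₃ d₄ i j i' j' hij hi hj _ _ _
  | equivariant h hd j σ τ f g => exact T.equivariant h hd j σ τ _ _
  | of_add => simp [Term.eval]
  | of_smul => simp [Term.eval]
  | of_act => exact s.map_action _ _ _ _

/-- The unique homomorphism `F(E) → T` of operads which restricts to `s` on `E`. -/
def lift (s : E.Hom T.toGrCollection) : (FreeOperad E).Hom T where
  toLin n p :=
    { toFun := Quotient.lift (Term.eval s) fun _ _ h => Rel.eval_eq s h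
      map_add' := by
        rintro ⟨y⟩ ⟨z⟩
        rfl
      map_smul' := by
        rintro c ⟨y⟩
        rfl }
  map_action := by
    rintro n p σ ⟨y⟩
    rfl
  map_comp := by
    rintro m n l p q r h hd i ⟨f⟩ ⟨g⟩
    rfl

theorem lift_of (s : E.Hom T.toGrCollection) (n : ℕ+) (p : ℤ) (y : E.obj n p) :
    (lift s).toLin n p ((of E).toLin n p y) = s.toLin n p y := rfl

theorem lift_unique (s : E.Hom T.toGrCollection) (φ : (FreeOperad E).Hom T)
    (hφ : ∀ n p (y : E.obj n p), φ.toLin n p ((of E).toLin n p y) = s.toLin n p y) :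
    φ = lift s := by
  have key : ∀ (n : ℕ+) (p : ℤ) (y : Term E n p),
      φ.toLin n p (Quotient.mk _ y : Carrier E n p) = y.eval s := by
    intro n p y
    induction y with
    | of y => exact hφ _ _ y
    | zero => exact map_zero _
    | add y z ihy ihz =>
      exact ((φ.toLin _ _).map_add (Quotient.mk _ y : Carrier E _ _)
        (Quotient.mk _ z : Carrier E _ _)).trans
        (congrArg₂ (· + ·) ihy ihz)
    | smul c y ih =>
      exact ((φ.toLin _ _).map_smul c (Quotient.mk _ y : Carrier E _ _)).trans
        (congrArg (c • ·) ih)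
    | act σ y ih =>
      exact (φ.map_action _ _ σ (Quotient.mk _ y : Carrier E _ _)).trans
        (congrArg (T.action _ _ σ) ih)
    | comp h hd i f g ihf ihg =>
      refine (φ.map_comp h hd i (Quotient.mk _ f : Carrier E _ _)
        (Quotient.mk _ g : Carrier E _ _)).trans ?_
      rw [ihf, ihg]
      rfl
  have h : φ.toLin = (lift s).toLin := by
    funext n p
    ext ⟨y⟩
    exact key n p y
  obtain ⟨⟨φ₀, _⟩, _⟩ := φ
  have h' : φ₀ = (lift s).toLin := h
  subst h'
  rfl

variable (E) in
/-- The elements of `F^d(E)`: linear combinations of composites of exactly `d` generators. -/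
inductive HasWeight : ℕ → ∀ {n : ℕ+} {p : ℤ}, (FreeOperad E).obj n p → Prop
  | of {n : ℕ+} {p : ℤ} (y : E.obj n p) : HasWeight 1 ((of E).toLin n p y)
  | zero {d : ℕ} {n : ℕ+} {p : ℤ} : HasWeight d (0 : (FreeOperad E).obj n p)
  | add {d : ℕ} {n : ℕ+} {p : ℤ} {y z : (FreeOperad E).obj n p} :
      HasWeight d y → HasWeight d z → HasWeight d (y + z)
  | smul {d : ℕ} {n : ℕ+} {p : ℤ} (c : k) {y : (FreeOperad E).obj n p} :
      HasWeight d y → HasWeight d (c • y)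
  | act {d : ℕ} {n : ℕ+} {p : ℤ} (σ : Equiv.Perm (Fin n)) {y : (FreeOperad E).obj n p} :
      HasWeight d y → HasWeight d ((FreeOperad E).action n p σ y)
  | comp {d e : ℕ} {m n l : ℕ+} {p q r : ℤ} (h : (m : ℕ) + n = l + 1) (hd : p + q = r)
      (i : Fin n) {f : (FreeOperad E).obj m p} {g : (FreeOperad E).obj n q} :
      HasWeight d f → HasWeight e g → HasWeight (d + e) ((FreeOperad E).comp h hd i f g)

variable (E) in
/-- The weight component `F^d(E)(n)` (in degree `p`). -/
def weight (d : ℕ) (n : ℕ+) (p : ℤ) : Submodule k ((FreeOperad E).obj n p) where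
  carrier := {y | HasWeight E d y}
  add_mem' := HasWeight.add
  zero_mem' := HasWeight.zero
  smul_mem' c _ := HasWeight.smul c

variable (E) in
/-- `F^{≥ d}(E)(n)` (in degree `p`). -/
def weightGE (d : ℕ) (n : ℕ+) (p : ℤ) : Submodule k ((FreeOperad E).obj n p) :=
  ⨆ e ≥ d, weight E e n p

end FreeOperad

/-! Over a field of characteristic zero, free operads are projective with respect to epimorphisms of
operads, since equivariant lifts exist over the group algebras of the symmetric groups. If
`S(1) = 0`, then Nakayama's lemma holds: by induction on the arity, a homomorphism to `S` which is
surjective modulo decomposables is surjective. Hence `α : F(Q) → S`, whose kernel is decomposable,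
is a projective cover, and (iii) is the usual embedding of a projective cover into any other
projective: projectivity gives `β : F(Q) → F(Q')` and `γ : F(Q') → F(Q)` over `S`, and `φ = γ β` is
surjective by Nakayama because `α φ = α`. A right inverse `ψ` of `φ` again lies over `S`, hence is
surjective too, so `φ` is bijective and `β` is injective. -/

theorem exists_intertwiningMap_comp_eq {k G V W U : Type*} [Field k] [Group G] [Finite G]
    [NeZero (Nat.card G : k)] [AddCommGroup V] [Module k V] [AddCommGroup W] [Module k W]
    [AddCommGroup U] [Module k U] {ρ : Representation k G V} {σ : Representation k G W}
    {τ : Representation k G U} (f : σ.IntertwiningMap τ) (hf : Function.Surjective f)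
    (g : ρ.IntertwiningMap τ) : ∃ h : ρ.IntertwiningMap σ, f.comp h = g := by
  let e₁ := Representation.IntertwiningMap.equivLinearMapAsModule ρ σ
  let e₂ := Representation.IntertwiningMap.equivLinearMapAsModule ρ τ
  let e₃ := Representation.IntertwiningMap.equivLinearMapAsModule σ τ
  obtain ⟨h, hh⟩ := IsSemisimpleModule.lifting_property (e₃ f) hf (e₂ g)
  exact ⟨e₁.symm h, e₂.injective hh⟩

namespace GrCollection

variable {k : Type*} [Field k]

/-- The identity map of a collection. -/
protected def Hom.id (E : GrCollection k) : E.Hom E where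
  toLin _ _ := LinearMap.id
  map_action _ _ _ _ := rfl

/-- The composition of maps of collections, in the order of functions. -/
protected def Hom.comp {E F G : GrCollection k} (ψ : F.Hom G) (φ : E.Hom F) : E.Hom G where
  toLin n p := ψ.toLin n p ∘ₗ φ.toLin n p
  map_action n p σ x := by
    simp only [LinearMap.comp_apply, φ.map_action, ψ.map_action]

theorem Hom.exists_lift [CharZero k] {E F G : GrCollection k} (f : F.Hom G)
    (hf : ∀ n p, Function.Surjective (f.toLin n p)) (g : E.Hom G) :
    ∃ t : E.Hom F, ∀ n p x, f.toLin n p (t.toLin n p x) = g.toLin n p x := by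
  have exists_lift_component (n : ℕ+) (p : ℤ) :=
    exists_intertwiningMap_comp_eq
      ((f.toLin n p).intertwiningMap_of_isIntertwiningMap _ _ (f.map_action n p)) (hf n p)
      ((g.toLin n p).intertwiningMap_of_isIntertwiningMap _ _ (g.map_action n p))
  choose t ht using exists_lift_component
  exact ⟨⟨fun n p => (t n p).toLinearMap, fun n p => (t n p).isIntertwining⟩,
    fun n p x => congr($(ht n p) x)⟩

end GrCollection

namespace NonunitalOperad

variable {k : Type*} [Field k] {R S T : NonunitalOperad k}

/-- The identity homomorphism of an operad. -/
protected def Hom.id (S : NonunitalOperad k) : S.Hom S where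
  toHom := GrCollection.Hom.id S.toGrCollection
  map_comp _ _ _ _ _ := rfl

/-- The composition of homomorphisms of operads, in the order of functions. -/
protected def Hom.comp (ψ : S.Hom T) (φ : R.Hom S) : R.Hom T where
  toHom := ψ.toHom.comp φ.toHom
  map_comp h hd i f g := by
    simp only [GrCollection.Hom.comp, LinearMap.comp_apply, φ.map_comp, ψ.map_comp]

theorem projection_surjective (S : NonunitalOperad k) (n : ℕ+) (p : ℤ) :
    Function.Surjective (S.projection.toLin n p) :=
  Submodule.mkQ_surjective _

theorem projection_eq_zero_iff {n : ℕ+} {p : ℤ} {x : S.obj n p} :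
    S.projection.toLin n p x = 0 ↔ x ∈ S.decomposables n p :=
  Submodule.Quotient.mk_eq_zero _

theorem exists_isSection [CharZero k] (S : NonunitalOperad k) :
    ∃ s : S.indecomposables.Hom S.toGrCollection, S.IsSection s :=
  GrCollection.Hom.exists_lift S.projection S.projection_surjective
    (GrCollection.Hom.id S.indecomposables)

theorem isReduced_indecomposables (hS : S.IsReduced) : S.indecomposables.IsReduced := by
  intro p x
  obtain ⟨y, rfl⟩ := S.projection_surjective 1 p x
  rw [hS p y, map_zero]

theorem comp_mem_decomposables {m n l : ℕ+} {p q r : ℤ} (h : (m : ℕ) + n = l + 1)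
    (hd : p + q = r) (i : Fin n) (f : S.obj m p) (g : S.obj n q) :
    S.comp h hd i f g ∈ S.decomposables l r :=
  Submodule.subset_span ⟨m, n, p, q, h, hd, i, f, g, 1, by simp⟩

theorem Hom.decomposables_le_comap (φ : S.Hom T) (n : ℕ+) (p : ℤ) :
    S.decomposables n p ≤ (T.decomposables n p).comap (φ.toLin n p) := by
  refine Submodule.span_le.2 ?_
  rintro _ ⟨a, b, d, e, h, hd, i, f, g, σ, rfl⟩
  refine Submodule.subset_span ⟨a, b, d, e, h, hd, i, φ.toLin a d f, φ.toLin b e g, σ, ?_⟩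
  rw [φ.map_action, φ.map_comp]

theorem Hom.projection_map_eq_of_projection_eq (φ : S.Hom T) {n : ℕ+} {p : ℤ} {x y : S.obj n p}
    (hxy : S.projection.toLin n p x = S.projection.toLin n p y) :
    T.projection.toLin n p (φ.toLin n p x) = T.projection.toLin n p (φ.toLin n p y) := by
  rw [← sub_eq_zero, ← map_sub, projection_eq_zero_iff] at hxy ⊢
  rw [← map_sub]
  exact φ.decomposables_le_comap n p hxy

theorem comp_eq_zero_or_lt (hS : S.IsReduced) {m n l : ℕ+} {p q r : ℤ}
    (h : (m : ℕ) + n = l + 1) (hd : p + q = r) (i : Fin n) (f : S.obj m p) (g : S.obj n q) :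
    S.comp h hd i f g = 0 ∨ m < l ∧ n < l := by
  rcases eq_or_ne m 1 with rfl | hm
  · left; rw [hS p f, map_zero, LinearMap.zero_apply]
  rcases eq_or_ne n 1 with rfl | hn
  · left; rw [hS q g, map_zero]
  rw [Ne, ← PNat.coe_eq_one_iff] at hm hn
  have := m.pos
  have := n.pos
  exact .inr ⟨PNat.coe_lt_coe _ _ |>.1 (by omega), PNat.coe_lt_coe _ _ |>.1 (by omega)⟩

theorem Hom.isEpi_of_surjective_projection_comp (hT : T.IsReduced) (φ : S.Hom T)
    (hφ : ∀ n p, Function.Surjective (T.projection.toLin n p ∘ φ.toLin n p)) : φ.IsEpi := by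
  intro n
  induction n using PNat.strongInductionOn with
  | _ n ih =>
  intro p x
  have decomposables_le : T.decomposables n p ≤ LinearMap.range (φ.toLin n p) := by
    refine Submodule.span_le.2 ?_
    rintro _ ⟨a, b, d, e, h, hd, i, f, g, σ, rfl⟩
    rcases comp_eq_zero_or_lt hT h hd i f g with h₀ | ⟨ha, hb⟩
    · rw [h₀, map_zero]
      exact zero_mem _
    · obtain ⟨f, rfl⟩ := ih a ha d f
      obtain ⟨g, rfl⟩ := ih b hb e g
      exact ⟨S.action n p σ (S.comp h hd i f g), by rw [φ.map_action, φ.map_comp]⟩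
  obtain ⟨y, hy⟩ := hφ n p (T.projection.toLin n p x)
  have hxy : x - φ.toLin n p y ∈ T.decomposables n p := by
    rw [← projection_eq_zero_iff, map_sub, sub_eq_zero]
    exact hy.symm
  exact (Submodule.sub_mem_iff_left _ (LinearMap.mem_range_self _ y)).1 (decomposables_le hxy)

theorem Hom.isEpi_of_isEpi_comp_of_ker_le (hS : S.IsReduced) {α : S.Hom T}
    (hker : ∀ n p, LinearMap.ker (α.toLin n p) ≤ S.decomposables n p) {φ : R.Hom S}
    (hαφ : (α.comp φ).IsEpi) : φ.IsEpi := by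
  refine φ.isEpi_of_surjective_projection_comp hS fun n p z => ?_
  obtain ⟨x, rfl⟩ := S.projection_surjective n p z
  obtain ⟨y, hy⟩ := hαφ n p (α.toLin n p x)
  have hxy : φ.toLin n p y - x ∈ LinearMap.ker (α.toLin n p) := by
    rw [LinearMap.mem_ker, map_sub, sub_eq_zero]
    exact hy
  refine ⟨y, sub_eq_zero.1 ?_⟩
  rw [Function.comp_apply, ← map_sub, projection_eq_zero_iff]
  exact hker n p hxy

end NonunitalOperad

namespace FreeOperad

open NonunitalOperad

variable {k : Type*} [Field k] {E E' : GrCollection k} {S T : NonunitalOperad k}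

@[elab_as_elim]
theorem induction_on {motive : ∀ {n : ℕ+} {p : ℤ}, (FreeOperad E).obj n p → Prop}
    {n : ℕ+} {p : ℤ} (x : (FreeOperad E).obj n p)
    (of : ∀ {n p} (y : E.obj n p), motive ((of E).toLin n p y))
    (zero : ∀ {n p}, motive (0 : (FreeOperad E).obj n p))
    (add : ∀ {n p} (y z : (FreeOperad E).obj n p), motive y → motive z → motive (y + z))
    (smul : ∀ {n p} (c : k) (y : (FreeOperad E).obj n p), motive y → motive (c • y))
    (act : ∀ {n : ℕ+} {p : ℤ} (σ : Equiv.Perm (Fin n)) (y : (FreeOperad E).obj n p), motive y →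
      motive ((FreeOperad E).action n p σ y))
    (comp : ∀ {m n l : ℕ+} {p q r : ℤ} (h : (m : ℕ) + n = l + 1) (hd : p + q = r) (i : Fin n)
      (f : (FreeOperad E).obj m p) (g : (FreeOperad E).obj n q), motive f → motive g →
      motive ((FreeOperad E).comp h hd i f g)) : motive x := by
  obtain ⟨x, rfl⟩ := Quotient.exists_rep x
  induction x with
  | of y => exact of y
  | zero => exact zero
  | add y z hy hz => exact add _ _ hy hz
  | smul c y hy => exact smul c _ hy
  | act σ y hy => exact act σ _ hy
  | comp h hd i f g hf hg => exact comp h hd i _ _ hf hg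

theorem isReduced (hE : E.IsReduced) : (FreeOperad E).IsReduced := by
  suffices eq_zero_of_arity_eq_one : ∀ {n : ℕ+} {p : ℤ} (x : (FreeOperad E).obj n p),
      (n : ℕ) = 1 → x = 0 from fun p x => eq_zero_of_arity_eq_one x rfl
  intro n p x
  induction x using induction_on with
  | @of n p y =>
    intro hn
    obtain rfl : n = 1 := PNat.coe_eq_one_iff.1 hn
    rw [hE p y, map_zero]
  | zero => exact fun _ => rfl
  | add y z hy hz => exact fun hn => by rw [hy hn, hz hn, add_zero]
  | smul c y hy => exact fun hn => by rw [hy hn, smul_zero]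
  | act σ y hy => exact fun hn => by rw [hy hn, map_zero]
  | @comp m n l p q r h hd i f g hf _ =>
    intro hl
    have := n.pos
    have := m.pos
    rw [hf (by omega), map_zero, LinearMap.zero_apply]

theorem exists_projection_of_eq {n : ℕ+} {p : ℤ} (x : (FreeOperad E).obj n p) :
    ∃ y : E.obj n p, (FreeOperad E).projection.toLin n p ((of E).toLin n p y) =
      (FreeOperad E).projection.toLin n p x := by
  induction x using induction_on with
  | of y => exact ⟨y, rfl⟩
  | zero => exact ⟨0, by rw [map_zero]⟩
  | add _ _ hy hz =>
    obtain ⟨y, hy⟩ := hy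
    obtain ⟨z, hz⟩ := hz
    exact ⟨y + z, by rw [map_add, map_add, map_add, hy, hz]⟩
  | smul c _ hy =>
    obtain ⟨y, hy⟩ := hy
    exact ⟨c • y, by rw [map_smul, map_smul, map_smul, hy]⟩
  | act σ _ hy =>
    obtain ⟨y, hy⟩ := hy
    refine ⟨E.action _ _ σ y, ?_⟩
    rw [GrCollection.Hom.map_action, GrCollection.Hom.map_action, hy,
      GrCollection.Hom.map_action]
  | comp h hd i f g =>
    refine ⟨0, ?_⟩
    rw [map_zero, map_zero, projection_eq_zero_iff.2 (comp_mem_decomposables h hd i f g)]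

theorem hom_ext {φ ψ : (FreeOperad E).Hom T}
    (h : ∀ n p y, φ.toLin n p ((of E).toLin n p y) = ψ.toLin n p ((of E).toLin n p y)) :
    φ = ψ :=
  (lift_unique (ψ.toHom.comp (of E)) φ h).trans (lift_unique _ ψ fun _ _ _ => rfl).symm

theorem exists_comp_eq [CharZero k] {φ : S.Hom T} (hφ : φ.IsEpi) (ψ : (FreeOperad E).Hom T) :
    ∃ χ : (FreeOperad E).Hom S, φ.comp χ = ψ := by
  obtain ⟨t, ht⟩ := GrCollection.Hom.exists_lift φ.toHom hφ (ψ.toHom.comp (of E))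
  exact ⟨lift t, hom_ext ht⟩

theorem ker_le_decomposables_of_injective {φ : (FreeOperad E).Hom S}
    (hφ : ∀ n p, Function.Injective
      (S.projection.toLin n p ∘ₗ φ.toLin n p ∘ₗ (of E).toLin n p)) (n : ℕ+) (p : ℤ) :
    LinearMap.ker (φ.toLin n p) ≤ (FreeOperad E).decomposables n p := by
  intro x hx
  obtain ⟨y, hy⟩ := exists_projection_of_eq x
  have hy₀ : y = 0 := by
    refine (map_eq_zero_iff _ (hφ n p)).1 ?_
    rw [LinearMap.comp_apply, LinearMap.comp_apply, φ.projection_map_eq_of_projection_eq hy,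
      LinearMap.mem_ker.1 hx, map_zero]
  rw [← projection_eq_zero_iff, ← hy, hy₀, map_zero, map_zero]

theorem HasWeight.mem_weightGE {d e : ℕ} (hde : d ≤ e) {n : ℕ+} {p : ℤ}
    {x : (FreeOperad E).obj n p} (hx : HasWeight E e x) : x ∈ weightGE E d n p :=
  Submodule.mem_iSup_of_mem e (Submodule.mem_iSup_of_mem hde hx)

theorem weightGE_le {d : ℕ} {n : ℕ+} {p : ℤ} {N : Submodule k ((FreeOperad E).obj n p)}
    (hN : ∀ e ≥ d, ∀ x, HasWeight E e x → x ∈ N) : weightGE E d n p ≤ N :=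
  iSup₂_le fun e he x hx => hN e he x hx

theorem weightGE_anti {d e : ℕ} (hde : d ≤ e) (n : ℕ+) (p : ℤ) :
    weightGE E e n p ≤ weightGE E d n p :=
  weightGE_le fun _ he _ hx => hx.mem_weightGE (hde.trans he)

theorem weightGE_le_comap_action (d : ℕ) (n : ℕ+) (p : ℤ) (σ : Equiv.Perm (Fin n)) :
    weightGE E d n p ≤ (weightGE E d n p).comap ((FreeOperad E).action n p σ) :=
  weightGE_le fun _ he _ hx => (hx.act σ).mem_weightGE he

theorem comp_mem_weightGE {d e : ℕ} {m n l : ℕ+} {p q r : ℤ} (h : (m : ℕ) + n = l + 1)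
    (hd : p + q = r) (i : Fin n) {f : (FreeOperad E).obj m p} {g : (FreeOperad E).obj n q}
    (hf : f ∈ weightGE E d m p) (hg : g ∈ weightGE E e n q) :
    (FreeOperad E).comp h hd i f g ∈ weightGE E (d + e) l r := by
  suffices hf' : weightGE E d m p ≤
      (weightGE E (d + e) l r).comap (((FreeOperad E).comp h hd i).flip g) from hf' hf
  refine weightGE_le fun d' hd' f' hf' => ?_
  suffices hg' : weightGE E e n q ≤
      (weightGE E (d + e) l r).comap ((FreeOperad E).comp h hd i f') from hg' hg
  exact weightGE_le fun e' he' g' hg' => (hf'.comp h hd i hg').mem_weightGE (add_le_add hd' he')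

theorem mem_weightGE_one {n : ℕ+} {p : ℤ} (x : (FreeOperad E).obj n p) :
    x ∈ weightGE E 1 n p := by
  induction x using induction_on with
  | of y => exact (HasWeight.of y).mem_weightGE le_rfl
  | zero => exact zero_mem _
  | add y z hy hz => exact add_mem hy hz
  | smul c y hy => exact Submodule.smul_mem _ c hy
  | act σ y hy => exact weightGE_le_comap_action 1 _ _ σ hy
  | comp h hd i f g hf hg =>
    exact weightGE_anti one_le_two _ _ (comp_mem_weightGE (d := 1) (e := 1) h hd i hf hg)

theorem HasWeight.mem_decomposables {d : ℕ} (h2d : 2 ≤ d) {n : ℕ+} {p : ℤ}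
    {x : (FreeOperad E).obj n p} (hx : HasWeight E d x) :
    x ∈ (FreeOperad E).decomposables n p := by
  induction hx with
  | of y => omega
  | zero => exact zero_mem _
  | add _ _ hy hz => exact add_mem (hy h2d) (hz h2d)
  | smul c _ hy => exact Submodule.smul_mem _ c (hy h2d)
  | act σ _ hy => exact (FreeOperad E).decomposables_le_comap _ _ σ (hy h2d)
  | comp h hd i => exact comp_mem_decomposables h hd i _ _

theorem weightGE_two_eq_decomposables (n : ℕ+) (p : ℤ) :
    weightGE E 2 n p = (FreeOperad E).decomposables n p := by
  refine le_antisymm (weightGE_le fun e he x hx => hx.mem_decomposables he)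
    (Submodule.span_le.2 ?_)
  rintro _ ⟨a, b, d, e, h, hd, i, f, g, σ, rfl⟩
  exact weightGE_le_comap_action 2 n p σ
    (comp_mem_weightGE (d := 1) (e := 1) h hd i (mem_weightGE_one f) (mem_weightGE_one g))

theorem isEpi_lift (hS : S.IsReduced) {s : S.indecomposables.Hom S.toGrCollection}
    (hs : S.IsSection s) : (lift s).IsEpi :=
  (lift s).isEpi_of_surjective_projection_comp hS fun n p y =>
    ⟨(of S.indecomposables).toLin n p y, hs n p y⟩

theorem ker_lift_le_decomposables {s : S.indecomposables.Hom S.toGrCollection}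
    (hs : S.IsSection s) (n : ℕ+) (p : ℤ) :
    LinearMap.ker ((lift s).toLin n p) ≤ (FreeOperad S.indecomposables).decomposables n p :=
  ker_le_decomposables_of_injective (fun n p y z hyz =>
    (hs n p y).symm.trans (hyz.trans (hs n p z))) n p

theorem isMono_of_comp_eq_self [CharZero k] (hE : E.IsReduced) {α : (FreeOperad E).Hom S}
    (hα : α.IsEpi)
    (hker : ∀ n p, LinearMap.ker (α.toLin n p) ≤ (FreeOperad E).decomposables n p)
    {φ : (FreeOperad E).Hom (FreeOperad E)} (hφ : α.comp φ = α) : φ.IsMono := by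
  have isEpi_of_comp_eq_self {χ : (FreeOperad E).Hom (FreeOperad E)} (hχ : α.comp χ = α) :
      χ.IsEpi :=
    Hom.isEpi_of_isEpi_comp_of_ker_le (isReduced hE) hker (by rwa [hχ])
  obtain ⟨ψ, hψ⟩ := exists_comp_eq (isEpi_of_comp_eq_self hφ) (Hom.id (FreeOperad E))
  have hαψ : α.comp ψ = α :=
    calc α.comp ψ = (α.comp φ).comp ψ := by rw [hφ]
      _ = α.comp (φ.comp ψ) := rfl
      _ = α := by rw [hψ]; rfl
  intro n p
  have φ_leftInverse_ψ : Function.LeftInverse (φ.toLin n p) (ψ.toLin n p) :=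
    fun x => congr(($hψ).toLin n p x)
  exact (φ_leftInverse_ψ.rightInverse_of_surjective (isEpi_of_comp_eq_self hαψ n p)).injective

theorem exists_isMono_comp_eq [CharZero k] (hE : E.IsReduced) {α : (FreeOperad E).Hom S}
    (hα : α.IsEpi)
    (hker : ∀ n p, LinearMap.ker (α.toLin n p) ≤ (FreeOperad E).decomposables n p)
    {α' : (FreeOperad E').Hom S} (hα' : α'.IsEpi) :
    ∃ β : (FreeOperad E).Hom (FreeOperad E'), β.IsMono ∧ α'.comp β = α := by
  obtain ⟨β, hβ⟩ := exists_comp_eq hα' α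
  obtain ⟨γ, hγ⟩ := exists_comp_eq hα α'
  have hαγβ : α.comp (γ.comp β) = α :=
    calc α.comp (γ.comp β) = (α.comp γ).comp β := rfl
      _ = α := by rw [hγ, hβ]
  exact ⟨β, fun n p => .of_comp (isMono_of_comp_eq_self hE hα hker hαγβ n p), hβ⟩

end FreeOperad

theorem mainTheorem12_general {k : Type u} [Field k] [CharZero k] (S : NonunitalOperad.{u, v} k)
    (hS : S.IsReduced) :
    (∃ s : S.indecomposables.Hom S.toGrCollection, S.IsSection s) ∧
    ∀ s : S.indecomposables.Hom S.toGrCollection, S.IsSection s →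
      (FreeOperad.lift s).IsEpi ∧
      (∀ n p, LinearMap.ker ((FreeOperad.lift s).toLin n p) ≤
          FreeOperad.weightGE S.indecomposables 2 n p) ∧
      (∀ n p, FreeOperad.weightGE S.indecomposables 2 n p =
          (FreeOperad S.indecomposables).decomposables n p) ∧
      ∀ (Q' : GrCollection.{u, w} k) (α' : (FreeOperad Q').Hom S), α'.IsEpi →
        ∃ β : (FreeOperad S.indecomposables).Hom (FreeOperad Q'), β.IsMono ∧
          ∀ n p (y : (FreeOperad S.indecomposables).obj n p),
            α'.toLin n p (β.toLin n p y) = (FreeOperad.lift s).toLin n p y := by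
  refine ⟨S.exists_isSection, fun s hs => ?_⟩
  have hepi := FreeOperad.isEpi_lift hS hs
  have hker := FreeOperad.ker_lift_le_decomposables hs
  refine ⟨hepi, fun n p => (hker n p).trans_eq (FreeOperad.weightGE_two_eq_decomposables n p).symm,
    FreeOperad.weightGE_two_eq_decomposables, fun Q' α' hα' => ?_⟩
  obtain ⟨β, hβ, hα'β⟩ :=
    FreeOperad.exists_isMono_comp_eq (S.isReduced_indecomposables hS) hepi hker hα'
  exact ⟨β, hβ, fun n p y => congr(($hα'β).toLin n p y)⟩

theorem mainTheorem12 {k : Type u} [Field k] [CharZero k] (S : NonunitalOperad.{u, v} k)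
    (hS : S.IsReduced) :
    (∃ s : S.indecomposables.Hom S.toGrCollection, S.IsSection s) ∧
    ∀ s : S.indecomposables.Hom S.toGrCollection, S.IsSection s →
      -- (i)
      (FreeOperad.lift s).IsEpi ∧
      -- (ii)
      (∀ n p, LinearMap.ker ((FreeOperad.lift s).toLin n p) ≤
          FreeOperad.weightGE S.indecomposables 2 n p) ∧
      (∀ n p, FreeOperad.weightGE S.indecomposables 2 n p =
          (FreeOperad S.indecomposables).decomposables n p) ∧
      -- (iii)
      ∀ Q' : GrCollection.{u, w} k, Q'.IsReduced →
        ∀ α' : (FreeOperad Q').Hom S, α'.IsEpi →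
          ∃ β : (FreeOperad S.indecomposables).Hom (FreeOperad Q'), β.IsMono ∧
            ∀ n p (y : (FreeOperad S.indecomposables).obj n p),
              α'.toLin n p (β.toLin n p y) = (FreeOperad.lift s).toLin n p y := by
  obtain ⟨hsection, hcover⟩ := mainTheorem12_general S hS
  exact ⟨hsection, fun s hs => (hcover s hs).imp_right (.imp_right (.imp_right fun h Q' _ => h Q'))⟩
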